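/- For $d \in \mathbb{N}$, the generalised polynomial maps $\mathbb{R}^d \to \mathbb{R}$ are the smallest family of maps that contains all polynomial maps and is closed under sums, products and the floor function $g \mapsto \lfloor g \rfloor$. A generalised polynomial map on a set $\Omega \subset \mathbb{R}^d$ is the restriction to $\Omega$ of a generalised polynomial map on $\mathbb{R}^d$. Let $I$ be a finite set. A parametric generalised polynomial map $g_\bullet \colon \mathbb{Z} \to \mathbb{Z}$ with index set $I$ is a family of maps $g_\alpha \colon \mathbb{Z} \to \mathbb{Z}$, $\alpha \in \mathbb{R}^I$, such that the combined map $\mathbb{R}^I \times \mathbb{Z} \to \mathbb{R}$, $(\alpha, n) \mapsto g_\alpha(n)$, is a generalised polynomial map. For $N \in \mathbb{N} = \{1,2,\dots\}$ put $[N] = \{0,1,\dots,N-1\}$. **Proposition.** Let $g_\bullet \colon \mathbb{Z} \to \mathbb{Z}$ be a parametric generalised polynomial map with finite index set $I$. Then there exist real numbers $B, C, K > 0$, depending only on $g_\bullet$, such that for every real $R \geq 1$ and every integer $N \geq 1$ the set $\{\, g_\alpha|_{[N]} : \alpha \in \mathbb{R}^I,\ \|\alpha\|_\infty \leq R \,\}$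 is finite and $$\bigl|\{\, g_\alpha|_{[N]} : \alpha \in \mathbb{R}^I,\ \|\alpha\|_\infty \leq R \,\}\bigr| \leq K R^B N^C .$$ -/

import Mathlib

namespace BracketWords

/-- Generalised polynomial maps `ℝ^ι → ℝ`: the smallest family of maps that contains all polynomial
maps and is closed under sums, products and the floor function `g ↦ ⌊g⌋`. -/
inductive IsGenPoly {ι : Type*} : ((ι → ℝ) → ℝ) → Prop
  | poly (p : MvPolynomial ι ℝ) : IsGenPoly (fun x => MvPolynomial.eval x p)
  | add {g h : (ι → ℝ) → ℝ} : IsGenPoly g → IsGenPoly h → IsGenPoly (fun x => g x + h x)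
  | mul {g h : (ι → ℝ) → ℝ} : IsGenPoly g → IsGenPoly h → IsGenPoly (fun x => g x * h x)
  | floor {g : (ι → ℝ) → ℝ} : IsGenPoly g → IsGenPoly (fun x => (⌊g x⌋ : ℝ))

/-- The point of `ℝ^I × ℝ` with coordinates `α` and `t`; the index set is `Option I`, where the
index `none` carries the last coordinate `t`. -/
def combine {I : Type*} (α : I → ℝ) (t : ℝ) : Option I → ℝ :=
  fun o => o.elim t α

/-- A family `g : ℝ^I → ℝ^ℤ` is a parametric generalised polynomial map `ℤ → ℝ` with index set `I`
if the combined map `ℝ^I × ℤ → ℝ`, `(α, n) ↦ g α n`, is a generalised polynomial map on the domain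
`ℝ^I × ℤ`, i.e. the restriction to this domain of a generalised polynomial map
`G : ℝ^I × ℝ → ℝ`. -/
def IsParametricGenPoly {I : Type*} (g : (I → ℝ) → ℤ → ℝ) : Prop :=
  ∃ G : (Option I → ℝ) → ℝ, IsGenPoly G ∧ ∀ (α : I → ℝ) (n : ℤ), g α n = G (combine α (n : ℝ))

/-- The restriction of a sequence `f : ℤ → ℤ` to `[N] = {0, 1, …, N - 1}`. -/
def restrictTo (N : ℕ) (f : ℤ → ℤ) : Fin N → ℤ :=
  fun n => f ((n : ℕ) : ℤ)

end BracketWords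

/-!
A map built from polynomials with finitely many floors is, for fixed `n`, piecewise polynomial in the
parameter `α`: once the values of the inner floors are known, the argument of the next floor is a
polynomial in `α` of bounded degree, and the value `⌊Q(α)⌋ = m` is decided by the signs of `Q - m` and
`Q - (m + 1)`. All values involved are polynomially bounded in `X = 2RN`, so the whole sequence
`g_α(0), …, g_α(N - 1)` is decided by the sign pattern at `α` of polynomially many polynomials, all
from one finite-dimensional space `V` that depends only on `g`. This is
`IsGenPoly.isPiecewise`, by induction on the construction of the map; the floor is treated in
`IsPiecewise.exists_floor_eq_of_sameSigns`.

It remains to bound the number of sign patterns of `M` functions from `V` polynomially in `M`. No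
real algebraic geometry is needed: evaluation at a point is linear on `V`, so a family of functions
whose sign patterns are all realised is linearly independent (`linearIndepOn_of_shatters`). Hence the
Vapnik–Chervonenkis dimension is at most `dim V`, and the Sauer–Shelah lemma gives at most
`(M + 1) ^ dim V` sign patterns (`card_signPatterns_le`).
-/

namespace BracketWords

/-! ### Sign patterns of functions from a finite-dimensional space -/

/-- A set of indices shattered by the sign patterns of a family of real functions indexes a
linearly independent subfamily: a nontrivial relation `∑ c i • v i = 0` with some `c i > 0` forbids
the sign pattern in which `v i < 0` exactly where `c i > 0`. -/
theorem linearIndepOn_of_shatters {X κ : Type*} [DecidableEq κ]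
    (v : κ → X → ℝ) (𝒜 : Finset (Finset κ))
    (h𝒜 : ∀ A ∈ 𝒜, ∃ x, ∀ i, i ∈ A ↔ 0 ≤ v i x) (t : Finset κ) (ht : 𝒜.Shatters t) :
    LinearIndepOn ℝ v (t : Set κ) := by
  have key : ∀ c : κ → ℝ, ∑ i ∈ t, c i • v i = 0 → ∀ i ∈ t, c i ≤ 0 := by
    intro c hc i hi
    by_contra! hpos
    obtain ⟨u, hu, hut⟩ := ht (t := t.filter (fun j => c j ≤ 0)) (Finset.filter_subset _ _)
    obtain ⟨x, hx⟩ := h𝒜 u hu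
    have hsign : ∀ j ∈ t, (0 ≤ v j x ↔ c j ≤ 0) := by
      intro j hj
      have := congrArg (j ∈ ·) hut
      simpa [hj, hx] using this
    have hsum : ∑ j ∈ t, c j * v j x = 0 := by
      simpa using congrFun hc x
    have hlt : ∑ j ∈ t, c j * v j x < ∑ j ∈ t, (0 : ℝ) := by
      refine Finset.sum_lt_sum (fun j hj => ?_) ⟨i, hi, ?_⟩
      · rcases le_or_gt (c j) 0 with h | h
        · exact mul_nonpos_of_nonpos_of_nonneg h ((hsign j hj).2 h)
        · have : v j x < 0 := by
            by_contra! h'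
            exact absurd ((hsign j hj).1 h') (not_le.2 h)
          exact mul_nonpos_of_nonneg_of_nonpos h.le this.le
      · have : v i x < 0 := by
          by_contra! h'
          exact absurd ((hsign i hi).1 h') (not_le.2 hpos)
        exact mul_neg_of_pos_of_neg hpos this
    simp [hsum] at hlt
  rw [linearIndepOn_finset_iff]
  intro c hc i hi
  refine le_antisymm (key c hc i hi) ?_
  have := key (fun j => -c j) (by simpa using hc) i hi
  linarith

/-- A family of functions from a finite-dimensional space `V` has polynomially many sign patterns:
their Vapnik–Chervonenkis dimension is at most `dim V`, so the Sauer–Shelah lemma applies. -/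
theorem card_signPatterns_le {X κ : Type*} [Fintype κ] [DecidableEq κ]
    (V : Submodule ℝ (X → ℝ)) [FiniteDimensional ℝ V] (v : κ → X → ℝ) (hv : ∀ i, v i ∈ V)
    (𝒜 : Finset (Finset κ)) (h𝒜 : ∀ A ∈ 𝒜, ∃ x, ∀ i, i ∈ A ↔ 0 ≤ v i x) :
    𝒜.card ≤ (Fintype.card κ + 1) ^ Module.finrank ℝ V := by
  have hvc : 𝒜.vcDim ≤ Module.finrank ℝ V := by
    refine Finset.sup_le fun t ht => ?_
    have hli := linearIndepOn_of_shatters v 𝒜 h𝒜 t (Finset.mem_shatterer.1 ht)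
    have hli' : LinearIndependent ℝ (fun i : (t : Set κ) => (⟨v i, hv i⟩ : V)) :=
      LinearIndependent.of_comp V.subtype hli
    simpa using hli'.fintype_card_le_finrank
  calc 𝒜.card ≤ 𝒜.shatterer.card := 𝒜.card_le_card_shatterer
    _ ≤ ∑ k ∈ Finset.Iic 𝒜.vcDim, (Fintype.card κ).choose k := Finset.card_shatterer_le_sum_vcDim
    _ ≤ ∑ k ∈ Finset.Iic (Module.finrank ℝ V), (Fintype.card κ).choose k :=
      Finset.sum_le_sum_of_subset (Finset.Iic_subset_Iic.2 hvc)
    _ ≤ ∑ k ∈ Finset.range (Module.finrank ℝ V + 1),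
          (Fintype.card κ) ^ k * 1 ^ (Module.finrank ℝ V - k) * (Module.finrank ℝ V).choose k := by
      rw [Nat.range_succ_eq_Iic]
      refine Finset.sum_le_sum fun k hk => ?_
      have := Nat.choose_pos (Finset.mem_Iic.1 hk)
      rw [one_pow, mul_one]
      exact (Nat.choose_le_pow _ _).trans (Nat.le_mul_of_pos_right _ this)
    _ = _ := (add_pow _ _ _).symm

/-- Two points have the same sign pattern with respect to a set of functions. -/
def SameSigns {X : Type*} (S : Finset (X → ℝ)) (x y : X) : Prop :=
  ∀ f ∈ S, (0 ≤ f x ↔ 0 ≤ f y)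

/-- A map on `Y` that only depends on the sign pattern with respect to `S` takes polynomially many
values in `S.card`. -/
theorem ncard_image_le_of_sameSigns {X Z : Type*} (V : Submodule ℝ (X → ℝ))
    [FiniteDimensional ℝ V] (S : Finset (X → ℝ)) (hS : ∀ f ∈ S, f ∈ V) (Y : Set X) (F : X → Z)
    (hF : ∀ x ∈ Y, ∀ y ∈ Y, SameSigns S x y → F x = F y) :
    (F '' Y).Finite ∧ (F '' Y).ncard ≤ (S.card + 1) ^ Module.finrank ℝ V := by
  classical
  rcases Y.eq_empty_or_nonempty with rfl | ⟨x₀, -⟩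
  · simp
  have : Nonempty X := ⟨x₀⟩
  let sgn : X → Finset S := fun x => Finset.univ.filter fun f => 0 ≤ f.1 x
  have hfin : (sgn '' Y).Finite := Set.toFinite _
  have hcard := card_signPatterns_le V (fun f : S => f.1) (fun f => hS f f.2) hfin.toFinset (by
    intro A hA
    obtain ⟨x, -, rfl⟩ := hfin.mem_toFinset.1 hA
    exact ⟨x, fun f => by simp [sgn]⟩)
  rw [← Set.ncard_eq_toFinset_card _ hfin, Fintype.card_coe] at hcard
  have hrep : ∀ A ∈ sgn '' Y, ∃ x ∈ Y, sgn x = A := fun A hA => hA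
  choose! r hrY hr using hrep
  have hsub : F '' Y ⊆ (fun A => F (r A)) '' (sgn '' Y) := by
    rintro _ ⟨x, hx, rfl⟩
    have hmem : sgn x ∈ sgn '' Y := ⟨x, hx, rfl⟩
    refine ⟨sgn x, hmem, hF _ (hrY _ hmem) _ hx fun f hf => ?_⟩
    have := congrArg ((⟨f, hf⟩ : S) ∈ ·) (hr _ hmem)
    simpa [sgn] using this
  refine ⟨(hfin.image _).subset hsub, ?_⟩
  exact (Set.ncard_le_ncard hsub (hfin.image _)).trans ((Set.ncard_image_le hfin).trans hcard)

/-! ### Piecewise description of generalised polynomial maps -/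

/-- For each scale `X ≥ 2` there are polynomially many (in `X`) functions `S` of the parameter `α`,
the walls, and polynomially many functions `T`, the branches, all from one finite-dimensional space
independent of `X`, such that for each natural number `n ≤ X` the map `α ↦ G (α, n)` on the ball of
radius `X` agrees on each cell (sign pattern of `S`) with some branch; moreover `G` grows
polynomially. One exponent `C` serves all three bounds: constants are absorbed because `X ≥ 2`. -/
def IsPiecewise {I : Type*} [Fintype I] (G : (Option I → ℝ) → ℝ) : Prop :=
  ∃ (V : Submodule ℝ ((I → ℝ) → ℝ)) (C : ℕ), FiniteDimensional ℝ V ∧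
    ∀ X : ℝ, 2 ≤ X → ∃ S T : Finset ((I → ℝ) → ℝ),
      (∀ f ∈ S, f ∈ V) ∧ (∀ f ∈ T, f ∈ V) ∧ (S.card : ℝ) ≤ X ^ C ∧ (T.card : ℝ) ≤ X ^ C ∧
      ∀ n : ℕ, (n : ℝ) ≤ X → ∀ α : I → ℝ, ‖α‖ ≤ X →
        |G (combine α n)| ≤ X ^ C ∧
        ∃ Q ∈ T, ∀ β : I → ℝ, ‖β‖ ≤ X → SameSigns S α β → G (combine β n) = Q β

variable {I : Type*} [Fintype I] {G H : (Option I → ℝ) → ℝ}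

/-- Sums of powers of `X ≥ 2` are absorbed by a larger power. -/
theorem pow_add_pow_le {X : ℝ} (hX : 2 ≤ X) (a b : ℕ) : X ^ a + X ^ b ≤ X ^ (a + b + 1) := by
  have ha : 1 ≤ X ^ a := one_le_pow₀ (by linarith)
  have hb : 1 ≤ X ^ b := one_le_pow₀ (by linarith)
  rw [pow_succ, pow_add]
  nlinarith [mul_nonneg (sub_nonneg.2 ha) (sub_nonneg.2 hb),
    mul_le_mul_of_nonneg_left hX (by positivity : 0 ≤ X ^ a * X ^ b)]

theorem SameSigns.mono {X : Type*} {S S' : Finset (X → ℝ)} (h : S ⊆ S') {x y : X}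
    (hxy : SameSigns S' x y) : SameSigns S x y := fun f hf => hxy f (h hf)

theorem IsPiecewise.const (c : ℝ) : IsPiecewise (I := I) (fun _ => c) := by
  obtain ⟨C, hC⟩ := pow_unbounded_of_one_lt |c| (one_lt_two : (1 : ℝ) < 2)
  refine ⟨Submodule.span ℝ {fun _ => c}, C, inferInstance, fun X hX =>
    ⟨∅, {fun _ => c}, by simp, by simp, ?_, ?_,
      fun n _ α _ => ⟨?_, _, Finset.mem_singleton_self _, fun _ _ _ => rfl⟩⟩⟩
  · simp only [Finset.card_empty, Nat.cast_zero]; positivity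
  · simpa using one_le_pow₀ (by linarith : 1 ≤ X)
  · exact hC.le.trans (pow_le_pow_left₀ (by norm_num) hX C)

theorem IsPiecewise.parameter (i : I) : IsPiecewise (fun x : Option I → ℝ => x (some i)) := by
  refine ⟨Submodule.span ℝ {fun α => α i}, 1, inferInstance, fun X hX =>
    ⟨∅, {fun α => α i}, by simp, by simp, ?_, ?_,
      fun n _ α hα => ⟨?_, _, Finset.mem_singleton_self _, fun _ _ _ => rfl⟩⟩⟩
  · simp only [Finset.card_empty, Nat.cast_zero]; positivity
  · simp; linarith
  · simpa [combine] using (norm_le_pi_norm α i).trans hα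

theorem IsPiecewise.time : IsPiecewise (fun x : Option I → ℝ => x none) := by
  classical
  refine ⟨Submodule.span ℝ {fun _ => 1}, 2, inferInstance, fun X hX =>
    ⟨∅, (Finset.range (⌊X⌋₊ + 1)).image (fun n : ℕ => fun _ => (n : ℝ)), by simp, ?_, ?_, ?_,
      fun n hn α hα => ⟨?_, fun _ => (n : ℝ), ?_, fun _ _ _ => rfl⟩⟩⟩
  · intro f hf
    obtain ⟨n, -, rfl⟩ := Finset.mem_image.1 hf
    exact Submodule.mem_span_singleton.2 ⟨n, by ext; simp⟩
  · simp only [Finset.card_empty, Nat.cast_zero]; positivity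
  · refine (Nat.cast_le.2 Finset.card_image_le).trans ?_
    have := Nat.floor_le (by linarith : 0 ≤ X)
    simp only [Finset.card_range]; push_cast; nlinarith
  · simp only [combine, Option.elim, Nat.abs_cast]; nlinarith
  · refine Finset.mem_image.2 ⟨n, Finset.mem_range.2 (Nat.lt_succ_of_le (Nat.le_floor hn)), rfl⟩

theorem IsPiecewise.add (hG : IsPiecewise G) (hH : IsPiecewise H) :
    IsPiecewise (fun x => G x + H x) := by
  classical
  obtain ⟨V, C, hV, hG⟩ := hG
  obtain ⟨W, D, hW, hH⟩ := hH
  refine ⟨V ⊔ W, C + D + 1, inferInstance, fun X hX => ?_⟩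
  obtain ⟨S, T, hSV, hTV, hS, hT, hG⟩ := hG X hX
  obtain ⟨S', T', hSV', hTV', hS', hT', hH⟩ := hH X hX
  have hVW : V ≤ V ⊔ W := le_sup_left
  have hWV : W ≤ V ⊔ W := le_sup_right
  refine ⟨S ∪ S', Finset.image₂ (· + ·) T T', ?_, ?_, ?_, ?_, fun n hn α hα => ?_⟩
  · intro f hf
    exact (Finset.mem_union.1 hf).elim (fun h => hVW (hSV f h)) (fun h => hWV (hSV' f h))
  · intro f hf
    obtain ⟨a, ha, b, hb, rfl⟩ := Finset.mem_image₂.1 hf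
    exact add_mem (hVW (hTV a ha)) (hWV (hTV' b hb))
  · refine le_trans ?_ (pow_add_pow_le hX C D)
    exact (Nat.cast_le.2 (Finset.card_union_le S S')).trans (by push_cast; gcongr)
  · calc ((Finset.image₂ (· + ·) T T').card : ℝ) ≤ T.card * T'.card := by
          exact_mod_cast Finset.card_image₂_le _ _ _
      _ ≤ X ^ C * X ^ D := by gcongr
      _ ≤ X ^ (C + D + 1) := by
          rw [← pow_add]; exact pow_le_pow_right₀ (by linarith) (by omega)
  · obtain ⟨hb, Q, hQ, hGQ⟩ := hG n hn α hα
    obtain ⟨hb', Q', hQ', hHQ⟩ := hH n hn α hα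
    refine ⟨(abs_add_le _ _).trans ((add_le_add hb hb').trans (pow_add_pow_le hX C D)),
      Q + Q', Finset.mem_image₂_of_mem hQ hQ', fun β hβ hs => ?_⟩
    simp only [hGQ β hβ (hs.mono Finset.subset_union_left),
      hHQ β hβ (hs.mono Finset.subset_union_right)]
    rfl

theorem IsPiecewise.mul (hG : IsPiecewise G) (hH : IsPiecewise H) :
    IsPiecewise (fun x => G x * H x) := by
  classical
  obtain ⟨V, C, hV, hG⟩ := hG
  obtain ⟨W, D, hW, hH⟩ := hH
  have hVW : FiniteDimensional ℝ (V * W : Submodule ℝ ((I → ℝ) → ℝ)) :=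
    Module.Finite.iff_fg.2
      ((Module.Finite.iff_fg.1 hV).mul (Module.Finite.iff_fg.1 hW))
  refine ⟨(V ⊔ W) ⊔ V * W, C + D + 1, inferInstance, fun X hX => ?_⟩
  obtain ⟨S, T, hSV, hTV, hS, hT, hG⟩ := hG X hX
  obtain ⟨S', T', hSV', hTV', hS', hT', hH⟩ := hH X hX
  have hle : X ^ C * X ^ D ≤ X ^ (C + D + 1) := by
    rw [← pow_add]; exact pow_le_pow_right₀ (by linarith) (by omega)
  refine ⟨S ∪ S', Finset.image₂ (· * ·) T T', ?_, ?_, ?_, ?_, fun n hn α hα => ?_⟩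
  · intro f hf
    refine (le_sup_left : V ⊔ W ≤ (V ⊔ W) ⊔ V * W) ?_
    exact (Finset.mem_union.1 hf).elim (fun h => (le_sup_left : V ≤ V ⊔ W) (hSV f h))
      (fun h => (le_sup_right : W ≤ V ⊔ W) (hSV' f h))
  · intro f hf
    obtain ⟨a, ha, b, hb, rfl⟩ := Finset.mem_image₂.1 hf
    exact (le_sup_right : V * W ≤ (V ⊔ W) ⊔ V * W) (Submodule.mul_mem_mul (hTV a ha) (hTV' b hb))
  · refine le_trans ?_ (pow_add_pow_le hX C D)
    exact (Nat.cast_le.2 (Finset.card_union_le S S')).trans (by push_cast; gcongr)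
  · calc ((Finset.image₂ (· * ·) T T').card : ℝ) ≤ T.card * T'.card := by
          exact_mod_cast Finset.card_image₂_le _ _ _
      _ ≤ X ^ C * X ^ D := by gcongr
      _ ≤ _ := hle
  · obtain ⟨hb, Q, hQ, hGQ⟩ := hG n hn α hα
    obtain ⟨hb', Q', hQ', hHQ⟩ := hH n hn α hα
    refine ⟨?_, Q * Q', Finset.mem_image₂_of_mem hQ hQ', fun β hβ hs => ?_⟩
    · rw [abs_mul]
      exact (mul_le_mul hb hb' (abs_nonneg _) (by positivity)).trans hle
    · simp only [hGQ β hβ (hs.mono Finset.subset_union_left),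
        hHQ β hβ (hs.mono Finset.subset_union_right)]
      rfl

/-- The range of integers for which walls are needed: every `⌊x⌋` with `|x| ≤ X ^ C`, together with
its successor. -/
theorem card_Icc_ceil_le {X : ℝ} (hX : 2 ≤ X) (C : ℕ) :
    ((Finset.Icc (-⌈X ^ C⌉) (⌈X ^ C⌉ + 1)).card : ℝ) ≤ X ^ (C + 3) := by
  have h1 : (1 : ℝ) ≤ X ^ C := one_le_pow₀ (by linarith)
  have h2 := Int.ceil_lt_add_one (X ^ C)
  have h0 : 0 ≤ ⌈X ^ C⌉ := Int.ceil_nonneg (by linarith)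
  have h8 : (8 : ℝ) ≤ X ^ 3 := by
    calc (8 : ℝ) = 2 ^ 3 := by norm_num
      _ ≤ X ^ 3 := pow_le_pow_left₀ (by norm_num) hX 3
  have hc : ((Finset.Icc (-⌈X ^ C⌉) (⌈X ^ C⌉ + 1)).card : ℤ) = 2 * ⌈X ^ C⌉ + 2 := by
    rw [Int.card_Icc, Int.toNat_of_nonneg (by omega)]; ring
  have hc' : ((Finset.Icc (-⌈X ^ C⌉) (⌈X ^ C⌉ + 1)).card : ℝ) = 2 * ⌈X ^ C⌉ + 2 := by
    exact_mod_cast hc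
  rw [hc', pow_add]
  nlinarith

theorem floor_mem_Icc_ceil {x M : ℝ} (h : |x| ≤ M) : ⌊x⌋ ∈ Set.Icc (-⌈M⌉) ⌈M⌉ := by
  obtain ⟨h1, h2⟩ := abs_le.1 h
  constructor
  · rw [← Int.floor_neg]; exact Int.floor_le_floor h1
  · exact Int.cast_le (R := ℝ).1 ((Int.floor_le x).trans (h2.trans (Int.le_ceil M)))

/-- Adding the walls `Q - m`, for `Q` a branch and `m` an integer in the relevant range, makes the
integer part of `G` constant on cells. -/
theorem IsPiecewise.exists_floor_eq_of_sameSigns (hG : IsPiecewise G) :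
    ∃ (V : Submodule ℝ ((I → ℝ) → ℝ)) (C : ℕ), FiniteDimensional ℝ V ∧ (fun _ => 1) ∈ V ∧
      ∀ X : ℝ, 2 ≤ X → ∃ S : Finset ((I → ℝ) → ℝ),
        (∀ f ∈ S, f ∈ V) ∧ (S.card : ℝ) ≤ X ^ C ∧
        ∀ n : ℕ, (n : ℝ) ≤ X → ∀ α : I → ℝ, ‖α‖ ≤ X → |G (combine α n)| ≤ X ^ C ∧
          ∀ β : I → ℝ, ‖β‖ ≤ X → SameSigns S α β → ⌊G (combine β n)⌋ = ⌊G (combine α n)⌋ := by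
  classical
  obtain ⟨V, C, hV, hG⟩ := hG
  refine ⟨V ⊔ Submodule.span ℝ {fun _ => 1}, C + (C + (C + 3)) + 1, inferInstance,
    (le_sup_right : _ ≤ V ⊔ _) (Submodule.mem_span_singleton_self _), fun X hX => ?_⟩
  obtain ⟨S, T, hSV, hTV, hS, hT, hG⟩ := hG X hX
  let M := Finset.Icc (-⌈X ^ C⌉) (⌈X ^ C⌉ + 1)
  let U : Finset ((I → ℝ) → ℝ) := Finset.image₂ (fun Q (m : ℤ) => fun β => Q β - m) T M
  refine ⟨S ∪ U, ?_, ?_, fun n hn α hα => ?_⟩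
  · intro f hf
    rcases Finset.mem_union.1 hf with h | h
    · exact (le_sup_left : V ≤ V ⊔ _) (hSV f h)
    · obtain ⟨Q, hQ, m, -, rfl⟩ := Finset.mem_image₂.1 h
      refine sub_mem ((le_sup_left : V ≤ V ⊔ _) (hTV Q hQ)) ((le_sup_right : _ ≤ V ⊔ _) ?_)
      exact Submodule.mem_span_singleton.2 ⟨m, by ext; simp⟩
  · have hU : (U.card : ℝ) ≤ X ^ (C + (C + 3)) := by
      calc (U.card : ℝ) ≤ T.card * M.card := by
            rw [← Nat.cast_mul]; exact Nat.cast_le.2 (Finset.card_image₂_le _ _ _)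
        _ ≤ X ^ C * X ^ (C + 3) := by gcongr; exact card_Icc_ceil_le hX C
        _ = _ := (pow_add _ _ _).symm
    refine le_trans ?_ (pow_add_pow_le hX C (C + (C + 3)))
    exact (Nat.cast_le.2 (Finset.card_union_le S U)).trans (by push_cast; gcongr)
  · obtain ⟨hb, Q, hQ, hGQ⟩ := hG n hn α hα
    refine ⟨hb.trans (pow_le_pow_right₀ (by linarith) (by omega)), fun β hβ hs => ?_⟩
    have hα' : G (combine α n) = Q α := hGQ α hα fun _ _ => Iff.rfl
    have hβ' : G (combine β n) = Q β := hGQ β hβ (hs.mono Finset.subset_union_left)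
    obtain ⟨hm1, hm2⟩ := floor_mem_Icc_ceil hb
    have hwall : ∀ m ∈ M, ((m : ℝ) ≤ Q α ↔ (m : ℝ) ≤ Q β) := fun m hm => by
      simpa using hs _ (Finset.mem_union_right _ (Finset.mem_image₂_of_mem hQ hm))
    rw [hα'] at hm1 hm2 ⊢
    rw [hβ', Int.floor_eq_iff]
    constructor
    · exact (hwall _ (Finset.mem_Icc.2 ⟨hm1, by omega⟩)).1 (Int.floor_le _)
    · have h := hwall (⌊Q α⌋ + 1) (Finset.mem_Icc.2 ⟨by omega, by omega⟩)
      push_cast at h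
      exact not_le.1 fun hle => absurd (h.2 hle) (not_le.2 (Int.lt_floor_add_one _))

/-- The branches of `⌊G⌋` are constants, as the walls already separate its values. -/
theorem IsPiecewise.floor (hG : IsPiecewise G) : IsPiecewise (fun x => (⌊G x⌋ : ℝ)) := by
  classical
  obtain ⟨V, C, hV, h1, hG⟩ := hG.exists_floor_eq_of_sameSigns
  refine ⟨V, C + 3, hV, fun X hX => ?_⟩
  obtain ⟨S, hSV, hS, hG⟩ := hG X hX
  refine ⟨S, (Finset.Icc (-⌈X ^ C⌉) (⌈X ^ C⌉ + 1)).image fun (m : ℤ) => fun _ => (m : ℝ),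
    hSV, ?_, hS.trans (pow_le_pow_right₀ (by linarith) (by omega)),
    (Nat.cast_le.2 Finset.card_image_le).trans (card_Icc_ceil_le hX C), fun n hn α hα => ?_⟩
  · intro f hf
    obtain ⟨m, -, rfl⟩ := Finset.mem_image.1 hf
    convert V.smul_mem (m : ℝ) h1 using 1
    ext; simp
  · obtain ⟨hb, hfl⟩ := hG n hn α hα
    obtain ⟨hm1, hm2⟩ := floor_mem_Icc_ceil hb
    refine ⟨?_, fun _ => (⌊G (combine α n)⌋ : ℝ), Finset.mem_image.2
      ⟨_, Finset.mem_Icc.2 ⟨hm1, by omega⟩, rfl⟩, fun β hβ hs => by simp only [hfl β hβ hs]⟩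
    have hc := (Int.ceil_lt_add_one (X ^ C)).le
    have hfl' : |(⌊G (combine α n)⌋ : ℝ)| ≤ ⌈X ^ C⌉ := by
      exact_mod_cast abs_le.2 ⟨hm1, hm2⟩
    calc |(⌊G (combine α n)⌋ : ℝ)| ≤ X ^ C + X ^ 0 := by simpa using hfl'.trans hc
      _ ≤ X ^ (C + 0 + 1) := pow_add_pow_le hX C 0
      _ ≤ X ^ (C + 3) := pow_le_pow_right₀ (by linarith) (by omega)

theorem IsGenPoly.isPiecewise (hG : IsGenPoly G) : IsPiecewise G := by
  induction hG with
  | poly p =>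
    induction p using MvPolynomial.induction_on with
    | C a => simpa using IsPiecewise.const a
    | add p q hp hq => simpa using hp.add hq
    | mul_X p o hp =>
      rcases o with _ | i
      · simpa using hp.mul IsPiecewise.time
      · simpa using hp.mul (IsPiecewise.parameter i)
  | add _ _ hg hh => exact hg.add hh
  | mul _ _ hg hh => exact hg.mul hh
  | floor _ hg => exact hg.floor

end BracketWords

/-! ### Counting restrictions -/

theorem mainTheorem2 {I : Type*} [Fintype I] (g : (I → ℝ) → ℤ → ℤ)
    (hg : BracketWords.IsParametricGenPoly (fun (α : I → ℝ) (n : ℤ) => (g α n : ℝ))) :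
    ∃ B C K : ℝ, 0 < B ∧ 0 < C ∧ 0 < K ∧
      ∀ (R : ℝ) (N : ℕ), 1 ≤ R → 1 ≤ N →
        {s : Fin N → ℤ | ∃ α : I → ℝ, ‖α‖ ≤ R ∧ s = BracketWords.restrictTo N (g α)}.Finite ∧
        (({s : Fin N → ℤ | ∃ α : I → ℝ, ‖α‖ ≤ R ∧
            s = BracketWords.restrictTo N (g α)}.ncard : ℕ) : ℝ) ≤ K * R ^ B * (N : ℝ) ^ C := by
  obtain ⟨G, hG, hgG⟩ := hg
  obtain ⟨V, C, hV, -, hS⟩ := hG.isPiecewise.exists_floor_eq_of_sameSigns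
  set E : ℕ := (C + 0 + 1) * Module.finrank ℝ V + 1 with hE
  have hE0 : (0 : ℝ) < E := by rw [hE]; positivity
  refine ⟨E, E, 2 ^ E, hE0, hE0, by positivity, fun R N hR hN => ?_⟩
  have hN' : (1 : ℝ) ≤ N := by exact_mod_cast hN
  have hRN : 1 ≤ R * N := one_le_mul_of_one_le_of_one_le hR hN'
  -- The ball of radius `R` and the interval `[N]` both lie below the scale `2RN`.
  set X : ℝ := 2 * (R * N) with hXdef
  have hX : 2 ≤ X := by linarith
  have hRX : R ≤ X := by nlinarith
  have hNX : (N : ℝ) ≤ X := by nlinarith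
  obtain ⟨S, hSV, hScard, hfl⟩ := hS X hX
  have hset : {s : Fin N → ℤ | ∃ α : I → ℝ, ‖α‖ ≤ R ∧ s = BracketWords.restrictTo N (g α)} =
      (fun α => BracketWords.restrictTo N (g α)) '' {α | ‖α‖ ≤ R} := by
    ext s; simp [eq_comm]
  -- As `g` is integer-valued, it is the integer part of `G`.
  have hgfl : ∀ (α : I → ℝ) (n : ℕ), g α n = ⌊G (BracketWords.combine α n)⌋ := fun α n => by
    have h := hgG α n
    simp only [Int.cast_natCast] at h
    rw [← h, Int.floor_intCast]
  obtain ⟨hfin, hcard⟩ := BracketWords.ncard_image_le_of_sameSigns V S hSV {α | ‖α‖ ≤ R}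
    (fun α => BracketWords.restrictTo N (g α)) (by
      intro α hα β hβ hs
      ext ⟨n, hn⟩
      have hnX : (n : ℝ) ≤ X := le_trans (by exact_mod_cast hn.le) hNX
      simp only [BracketWords.restrictTo, hgfl]
      exact ((hfl n hnX α (hα.trans hRX)).2 β (hβ.trans hRX) hs).symm)
  rw [hset]
  refine ⟨hfin, ?_⟩
  calc _ ≤ ((S.card : ℝ) + 1) ^ Module.finrank ℝ V := by exact_mod_cast hcard
    _ ≤ (X ^ (C + 0 + 1)) ^ Module.finrank ℝ V := by
      gcongr
      refine le_trans ?_ (BracketWords.pow_add_pow_le hX C 0)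
      simpa using hScard
    _ = X ^ ((C + 0 + 1) * Module.finrank ℝ V) := (pow_mul _ _ _).symm
    _ ≤ X ^ E := pow_le_pow_right₀ (by linarith) (by omega)
    _ = 2 ^ E * R ^ (E : ℝ) * (N : ℝ) ^ (E : ℝ) := by
      rw [Real.rpow_natCast, Real.rpow_natCast, hXdef, mul_pow, mul_pow]; ring
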